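/- Let $R$ and $S$ be associative unital rings and let $C={}_SC_R$ be an $(S,R)$-bimodule (so $(sc)r=s(cr)$). A module over a ring is *super finitely presented* if it has a projective resolution by finitely generated projective modules. Suppose that $C$ is *semidualizing*: (a) $C$ is super finitely presented both as a left $S$-module and as a right $R$-module; (b) the homothety maps $S\to\operatorname{Hom}_{R^{op}}(C,C)$, $s\mapsto(c\mapsto sc)$, and $R\to\operatorname{Hom}_S(C,C)$, $r\mapsto(c\mapsto cr)$, are bijective; (c) $\operatorname{Ext}^i_S(C,C)=0$ and $\operatorname{Ext}^i_{R^{op}}(C,C)=0$ for all $i\ge 1$. (Right $R$-modules are identified with left $R^{op}$-modules.) 1. Let $M$ be a left $R$-module that is *weak flat* (level), i.e. $\operatorname{Tor}_1^R(F,M)=0$ for every super finitely presented right $R$-module $F$. Then $M$ belongs to the *Auslander class* $\mathcal{A}_C(R)$, that is: $\operatorname{Tor}^R_i(C,M)=0$ for all $i\ge 1$; $\operatorname{Ext}^i_S(C,C\otimes_R M)=0$ for all $i\ge 1$; and the evaluation map $\mu_M\colon M\to\operatorname{Hom}_S(C,C\otimes_R M)$, $m\mapsto(c\mapsto c\otimes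 m)$, is an isomorphism of left $R$-modules. 2. Let $N$ be a left $S$-module that is *weak injective* (absolutely clean), i.e. $\operatorname{Ext}^1_S(F,N)=0$ for every super finitely presented left $S$-module $F$. Then $N$ belongs to the *Bass class* $\mathcal{B}_C(S)$, that is: $\operatorname{Ext}^i_S(C,N)=0$ for all $i\ge 1$; $\operatorname{Tor}^R_i(C,\operatorname{Hom}_S(C,N))=0$ for all $i\ge 1$; and the evaluation map $\nu_N\colon C\otimes_R\operatorname{Hom}_S(C,N)\to N$, $c\otimes f\mapsto f(c)$, is an isomorphism of left $S$-modules. -/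

import Mathlib

open CategoryTheory
open scoped TensorProduct

universe u

noncomputable section

/-! ### Multiplication by a scalar as an endomorphism commuting with another action -/

/-- If the actions of `S` and `T` on `A` commute, then `a ↦ s a` is `T`-linear for `s` in `S`. -/
def leftHomothety {S : Type*} (T A : Type*) [Ring S] [Ring T] [AddCommGroup A] [Module S A]
    [Module T A] [SMulCommClass S T A] (s : S) : A →ₗ[T] A where
  toFun a := s • a
  map_add' := smul_add s
  map_smul' t a := smul_comm s t a

theorem leftHomothety_apply {S T A : Type*} [Ring S] [Ring T] [AddCommGroup A] [Module S A]
    [Module T A] [SMulCommClass S T A] (s : S) (a : A) : leftHomothety T A s a = s • a := rfl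

/-- If `A` is an `(S, R)`-bimodule, then `a ↦ a r` is left `S`-linear for `r` in `R`. -/
def rightHomothety {R : Type*} (S A : Type*) [Ring S] [Ring R] [AddCommGroup A] [Module S A]
    [Module Rᵐᵒᵖ A] [SMulCommClass S Rᵐᵒᵖ A] (r : R) : A →ₗ[S] A where
  toFun a := MulOpposite.op r • a
  map_add' := smul_add _
  map_smul' s a := (smul_comm s (MulOpposite.op r) a).symm

theorem rightHomothety_apply {R S A : Type*} [Ring S] [Ring R] [AddCommGroup A] [Module S A]
    [Module Rᵐᵒᵖ A] [SMulCommClass S Rᵐᵒᵖ A] (r : R) (a : A) :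
    rightHomothety S A r a = MulOpposite.op r • a := rfl

/-! ### The balanced tensor product `A ⊗_R M` over a (not necessarily commutative) ring

`A` is a right `R`-module, i.e. a module over `Rᵐᵒᵖ`; the product `a r` is `MulOpposite.op r • a`.
`M` is a left `R`-module. -/

section BalancedTensor

variable (R : Type*) [Ring R]

/-- The subgroup of `A ⊗_ℤ M` generated by the elements `(a r) ⊗ m - a ⊗ (r m)`. -/
def balancingRelations (A M : Type*) [AddCommGroup A] [Module Rᵐᵒᵖ A]
    [AddCommGroup M] [Module R M] : AddSubgroup (A ⊗[ℤ] M) :=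
  AddSubgroup.closure
    {x | ∃ (a : A) (r : R) (m : M), x = (MulOpposite.op r • a) ⊗ₜ[ℤ] m - a ⊗ₜ[ℤ] (r • m)}

/-- The tensor product `A ⊗_R M` of a right `R`-module `A` and a left `R`-module `M`. -/
def BalancedTensor (A M : Type*) [AddCommGroup A] [Module Rᵐᵒᵖ A]
    [AddCommGroup M] [Module R M] : Type _ :=
  (A ⊗[ℤ] M) ⧸ balancingRelations R A M

namespace BalancedTensor

variable {A A' A'' M : Type*} [AddCommGroup A] [Module Rᵐᵒᵖ A] [AddCommGroup A'] [Module Rᵐᵒᵖ A']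
  [AddCommGroup A''] [Module Rᵐᵒᵖ A''] [AddCommGroup M] [Module R M]

instance : AddCommGroup (BalancedTensor R A M) :=
  inferInstanceAs (AddCommGroup ((A ⊗[ℤ] M) ⧸ balancingRelations R A M))

/-- The projection `A ⊗_ℤ M → A ⊗_R M`. -/
def proj (A M : Type*) [AddCommGroup A] [Module Rᵐᵒᵖ A] [AddCommGroup M] [Module R M] :
    A ⊗[ℤ] M →+ BalancedTensor R A M :=
  QuotientAddGroup.mk' (balancingRelations R A M)

/-- The pure tensor `a ⊗ m` in `A ⊗_R M`. -/
def tmul (a : A) (m : M) : BalancedTensor R A M :=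
  proj R A M (a ⊗ₜ[ℤ] m)

theorem tmul_add (a : A) (m m' : M) : tmul R a (m + m') = tmul R a m + tmul R a m' := by
  unfold tmul; rw [TensorProduct.tmul_add]; exact map_add _ _ _

theorem add_tmul (a a' : A) (m : M) : tmul R (a + a') m = tmul R a m + tmul R a' m := by
  unfold tmul; rw [TensorProduct.add_tmul]; exact map_add _ _ _

theorem smul_tmul (a : A) (r : R) (m : M) :
    tmul R (MulOpposite.op r • a) m = tmul R a (r • m) := by
  unfold tmul
  rw [← sub_eq_zero, ← map_sub]
  exact (QuotientAddGroup.eq_zero_iff _).2 (AddSubgroup.subset_closure ⟨a, r, m, rfl⟩)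

theorem induction_on {p : BalancedTensor R A M → Prop} (x : BalancedTensor R A M)
    (zero : p 0) (tmul : ∀ a m, p (tmul R a m)) (add : ∀ x y, p x → p y → p (x + y)) : p x := by
  obtain ⟨y, rfl⟩ : ∃ y, proj R A M y = x :=
    QuotientAddGroup.mk'_surjective (balancingRelations R A M) x
  induction y using TensorProduct.induction_on with
  | zero => rw [map_zero]; exact zero
  | tmul a m => exact tmul a m
  | add x y hx hy => rw [map_add]; exact add _ _ hx hy

/-- The universal property: a biadditive map `f` with `f (a r) m = f a (r m)` induces an additive
map on `A ⊗_R M`. -/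
def lift {G : Type*} [AddCommGroup G] (f : A →+ M →+ G)
    (hf : ∀ (a : A) (r : R) (m : M), f (MulOpposite.op r • a) m = f a (r • m)) :
    BalancedTensor R A M →+ G :=
  QuotientAddGroup.lift (balancingRelations R A M)
    (TensorProduct.liftAddHom f (fun n a m => by simp)) (by
      refine (AddSubgroup.closure_le _).2 ?_
      rintro _ ⟨a, r, m, rfl⟩
      simp [hf])

@[simp] theorem lift_tmul {G : Type*} [AddCommGroup G] (f : A →+ M →+ G)
    (hf : ∀ (a : A) (r : R) (m : M), f (MulOpposite.op r • a) m = f a (r • m)) (a : A) (m : M) :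
    lift R f hf (tmul R a m) = f a m := rfl

variable {R} in
theorem addHom_ext {G : Type*} [AddCommGroup G] {f g : BalancedTensor R A M →+ G}
    (h : ∀ a m, f (tmul R a m) = g (tmul R a m)) : f = g := by
  ext x
  induction x using induction_on with
  | zero => simp
  | tmul a m => exact h a m
  | add x y hx hy => simp [hx, hy]

/-- The biadditive map `(a, m) ↦ a ⊗ m`. -/
def mk (A M : Type*) [AddCommGroup A] [Module Rᵐᵒᵖ A] [AddCommGroup M] [Module R M] :
    A →+ M →+ BalancedTensor R A M :=
  AddMonoidHom.mk' (fun a => AddMonoidHom.mk' (fun m => tmul R a m) (tmul_add R a))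
    (fun a a' => AddMonoidHom.ext (add_tmul R a a'))

/-- The additive map `f ⊗_R M : A ⊗_R M → A' ⊗_R M` induced by a map `f : A → A'` of right
`R`-modules; it sends `a ⊗ m` to `f a ⊗ m`. -/
def rTensor (M : Type*) [AddCommGroup M] [Module R M] (f : A →ₗ[Rᵐᵒᵖ] A') :
    BalancedTensor R A M →+ BalancedTensor R A' M :=
  lift R ((mk R A' M).comp f.toAddMonoidHom) (fun a r m => by
    change tmul R (f (MulOpposite.op r • a)) m = tmul R (f a) (r • m)
    rw [map_smul, smul_tmul])

@[simp] theorem rTensor_tmul (f : A →ₗ[Rᵐᵒᵖ] A') (a : A) (m : M) :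
    rTensor R M f (tmul R a m) = tmul R (f a) m := rfl

/-- If `A` is an `(S, R)`-bimodule, then `A ⊗_R M` is a left `S`-module through
`s (a ⊗ m) = (s a) ⊗ m`. -/
instance instModuleLeft {S : Type*} [Ring S] [Module S A] [SMulCommClass S Rᵐᵒᵖ A] :
    Module S (BalancedTensor R A M) where
  smul s := rTensor R M (leftHomothety Rᵐᵒᵖ A s)
  one_smul x := by
    change rTensor R M (leftHomothety Rᵐᵒᵖ A (1 : S)) x = x
    induction x using induction_on with
    | zero => rw [map_zero]
    | tmul a m => rw [rTensor_tmul, leftHomothety_apply, one_smul]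
    | add x y hx hy => rw [map_add, hx, hy]
  mul_smul s t x := by
    change rTensor R M (leftHomothety Rᵐᵒᵖ A (s * t)) x =
      rTensor R M (leftHomothety Rᵐᵒᵖ A s) (rTensor R M (leftHomothety Rᵐᵒᵖ A t) x)
    induction x using induction_on with
    | zero => simp only [map_zero]
    | tmul a m => simp only [rTensor_tmul, leftHomothety_apply, mul_smul]
    | add x y hx hy => rw [map_add, map_add, map_add, hx, hy]
  smul_zero s := map_zero (rTensor R M (leftHomothety Rᵐᵒᵖ A s))
  smul_add s := map_add (rTensor R M (leftHomothety Rᵐᵒᵖ A s))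
  add_smul s t x := by
    change rTensor R M (leftHomothety Rᵐᵒᵖ A (s + t)) x =
      rTensor R M (leftHomothety Rᵐᵒᵖ A s) x + rTensor R M (leftHomothety Rᵐᵒᵖ A t) x
    induction x using induction_on with
    | zero => simp only [map_zero, add_zero]
    | tmul a m => simp only [rTensor_tmul, leftHomothety_apply, add_smul, add_tmul]
    | add x y hx hy => rw [map_add, map_add, map_add, hx, hy]; abel
  zero_smul x := by
    change rTensor R M (leftHomothety Rᵐᵒᵖ A (0 : S)) x = 0
    induction x using induction_on with
    | zero => rw [map_zero]
    | tmul a m =>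
      rw [rTensor_tmul, leftHomothety_apply, zero_smul]
      exact DFunLike.congr_fun (map_zero (mk R A M)) m
    | add x y hx hy => rw [map_add, hx, hy, add_zero]

theorem smul_tmul_left {S : Type*} [Ring S] [Module S A] [SMulCommClass S Rᵐᵒᵖ A]
    (s : S) (a : A) (m : M) : s • tmul R a m = tmul R (s • a) m := rfl

end BalancedTensor

end BalancedTensor

/-! ### The left `R`-module `Hom_S(C, N)` for an `(S, R)`-bimodule `C` -/

section BimoduleHom

/-- `Hom_S(C, N)`, the group of left `S`-linear maps `C → N`, to be regarded as a left `R`-module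
when `C` is an `(S, R)`-bimodule. -/
def BimoduleHom (R S C N : Type*) [Ring R] [Ring S] [AddCommGroup C] [Module S C]
    [Module Rᵐᵒᵖ C] [SMulCommClass S Rᵐᵒᵖ C] [AddCommGroup N] [Module S N] : Type _ :=
  C →ₗ[S] N

variable (R S C N : Type*) [Ring R] [Ring S] [AddCommGroup C] [Module S C]
    [Module Rᵐᵒᵖ C] [SMulCommClass S Rᵐᵒᵖ C] [AddCommGroup N] [Module S N]

instance : AddCommGroup (BimoduleHom R S C N) := inferInstanceAs (AddCommGroup (C →ₗ[S] N))

instance : FunLike (BimoduleHom R S C N) C N := inferInstanceAs (FunLike (C →ₗ[S] N) C N)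

instance : LinearMapClass (BimoduleHom R S C N) S C N :=
  inferInstanceAs (LinearMapClass (C →ₗ[S] N) S C N)

/-- The left action of `R` on `Hom_S(C, N)`: `(r f)(c) = f (c r)`. -/
instance : Module R (BimoduleHom R S C N) where
  smul r f := LinearMap.comp (show C →ₗ[S] N from f) (rightHomothety S C r)
  one_smul f := LinearMap.ext fun c => congrArg f (one_smul Rᵐᵒᵖ c)
  mul_smul r t f := LinearMap.ext fun c =>
    congrArg f (mul_smul (MulOpposite.op t) (MulOpposite.op r) c)
  smul_zero _ := LinearMap.ext fun _ => rfl
  smul_add _ _ _ := LinearMap.ext fun _ => rfl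
  add_smul r t f := LinearMap.ext fun c =>
    (congrArg f (add_smul (MulOpposite.op r) (MulOpposite.op t) c)).trans (map_add f _ _)
  zero_smul f := LinearMap.ext fun c => (congrArg f (zero_smul Rᵐᵒᵖ c)).trans (map_zero f)

theorem BimoduleHom.smul_apply (r : R) (f : BimoduleHom R S C N) (c : C) :
    (r • f) c = f (MulOpposite.op r • c) := rfl

theorem BimoduleHom.add_apply (f g : BimoduleHom R S C N) (c : C) :
    (f + g) c = f c + g c := rfl

end BimoduleHom

/-! ### Tor over a (not necessarily commutative) ring -/

section Tor

variable (R : Type u) [Ring R] (M : Type u) [AddCommGroup M] [Module R M]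

/-- The functor `- ⊗_R M` from right `R`-modules to abelian groups. -/
def tensorRightFunctor : ModuleCat.{u} Rᵐᵒᵖ ⥤ AddCommGrpCat.{u} where
  obj A := AddCommGrpCat.of (BalancedTensor R A M)
  map f := AddCommGrpCat.ofHom (BalancedTensor.rTensor R M f.hom)
  map_id A := by
    ext1
    exact BalancedTensor.addHom_ext fun _ _ => rfl
  map_comp f g := by
    ext1
    exact BalancedTensor.addHom_ext fun _ _ => rfl

instance : (tensorRightFunctor R M).Additive where
  map_add {A B f g} := by
    ext1
    exact BalancedTensor.addHom_ext fun a m => BalancedTensor.add_tmul R (f.hom a) (g.hom a) m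

/-- `Tor_i^R(A, M)` for a right `R`-module `A` and a left `R`-module `M`: the `i`-th left derived
functor of `- ⊗_R M`, evaluated at `A`. -/
def TorGroup (A : Type u) [AddCommGroup A] [Module Rᵐᵒᵖ A] (i : ℕ) : AddCommGrpCat.{u} :=
  ((tensorRightFunctor R M).leftDerived i).obj (ModuleCat.of Rᵐᵒᵖ A)

end Tor

/-! ### Super finitely presented, weak injective and weak flat modules -/

/-- A left `R`-module is super finitely presented if it has a projective resolution by finitely
generated projective modules. -/
def IsSuperFinitelyPresented (R : Type u) [Ring R] (M : Type u) [AddCommGroup M] [Module R M] :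
    Prop :=
  ∃ P : ProjectiveResolution (ModuleCat.of R M), ∀ n : ℕ, Module.Finite R (P.complex.X n)

/-- A left `S`-module `N` is weak injective if `Ext¹_S(F, N) = 0` for all super finitely presented
left `S`-modules `F`. -/
def IsWeakInjective (S : Type u) [Ring S] (N : Type u) [AddCommGroup N] [Module S N] : Prop :=
  ∀ (F : Type u) [AddCommGroup F] [Module S F], IsSuperFinitelyPresented S F →
    Subsingleton (Abelian.Ext (ModuleCat.of S F) (ModuleCat.of S N) 1)

/-- A left `R`-module `M` is weak flat if `Tor₁^R(F, M) = 0` for all super finitely presented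
right `R`-modules `F`. -/
def IsWeakFlat (R : Type u) [Ring R] (M : Type u) [AddCommGroup M] [Module R M] : Prop :=
  ∀ (F : Type u) [AddCommGroup F] [Module Rᵐᵒᵖ F], IsSuperFinitelyPresented Rᵐᵒᵖ F →
    Subsingleton (TorGroup R M F 1)

/-! ### Semidualizing bimodules, the Auslander class and the Bass class -/

section Semidualizing

variable (R S C : Type u) [Ring R] [Ring S] [AddCommGroup C] [Module S C]
    [Module Rᵐᵒᵖ C] [SMulCommClass S Rᵐᵒᵖ C]

/-- An `(S, R)`-bimodule `C` is semidualizing. -/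
structure IsSemidualizing : Prop where
  /-- `C` is super finitely presented as a left `S`-module. -/
  a1 : IsSuperFinitelyPresented S C
  /-- `C` is super finitely presented as a right `R`-module. -/
  a2 : IsSuperFinitelyPresented Rᵐᵒᵖ C
  /-- The homothety map `S → Hom_{Rᵒᵖ}(C, C)`, `s ↦ (c ↦ s c)`, is bijective. -/
  b1 : Function.Bijective (fun s : S => leftHomothety Rᵐᵒᵖ C s)
  /-- The homothety map `R → Hom_S(C, C)`, `r ↦ (c ↦ c r)`, is bijective. -/
  b2 : Function.Bijective (fun r : R => rightHomothety S C r)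
  /-- `Ext^i_S(C, C) = 0` for `i ≥ 1`. -/
  c1 : ∀ i : ℕ, 1 ≤ i → Subsingleton (Abelian.Ext (ModuleCat.of S C) (ModuleCat.of S C) i)
  /-- `Ext^i_{Rᵒᵖ}(C, C) = 0` for `i ≥ 1`. -/
  c2 : ∀ i : ℕ, 1 ≤ i → Subsingleton (Abelian.Ext (ModuleCat.of Rᵐᵒᵖ C) (ModuleCat.of Rᵐᵒᵖ C) i)

/-- The evaluation map `μ_M : M → Hom_S(C, C ⊗_R M)`, `m ↦ (c ↦ c ⊗ m)`, which is left
`R`-linear. -/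
def auslanderEval (M : Type u) [AddCommGroup M] [Module R M] :
    M →ₗ[R] BimoduleHom R S C (BalancedTensor R C M) where
  toFun m :=
    { toFun := fun c => BalancedTensor.tmul R c m
      map_add' := fun c c' => BalancedTensor.add_tmul R c c' m
      map_smul' := fun s c => (BalancedTensor.smul_tmul_left R s c m).symm }
  map_add' m m' := LinearMap.ext fun c => BalancedTensor.tmul_add R c m m'
  map_smul' r m := LinearMap.ext fun c => (BalancedTensor.smul_tmul R c r m).symm

/-- The evaluation map `ν_N : C ⊗_R Hom_S(C, N) → N`, `c ⊗ f ↦ f c`, which is left `S`-linear. -/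
def bassEval (N : Type u) [AddCommGroup N] [Module S N] :
    BalancedTensor R C (BimoduleHom R S C N) →ₗ[S] N where
  __ := BalancedTensor.lift R
    (AddMonoidHom.mk' (fun c : C => AddMonoidHom.mk' (fun f : BimoduleHom R S C N => f c)
        (fun f g => BimoduleHom.add_apply R S C N f g c))
      (fun c c' => AddMonoidHom.ext fun f => map_add f c c'))
    (fun _ _ _ => rfl)
  map_smul' s x := by
    induction x using BalancedTensor.induction_on with
    | zero =>
      rw [smul_zero]
      refine (map_zero (BalancedTensor.lift R _ _)).trans ?_
      exact (smul_zero s).symm.trans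
        (congrArg (s • ·) (map_zero (BalancedTensor.lift R _ _)).symm)
    | tmul c f => exact map_smul f s c
    | add x y hx hy =>
      rw [smul_add]
      refine (map_add (BalancedTensor.lift R _ _) _ _).trans ?_
      refine (congrArg₂ (· + ·) hx hy).trans ?_
      refine (smul_add s _ _).symm.trans (congrArg (s • ·) ?_)
      exact (map_add (BalancedTensor.lift R _ _) x y).symm

theorem auslanderEval_apply (M : Type u) [AddCommGroup M] [Module R M] (m : M) (c : C) :
    auslanderEval R S C M m c = BalancedTensor.tmul R c m := rfl

theorem bassEval_tmul (N : Type u) [AddCommGroup N] [Module S N] (c : C)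
    (f : BimoduleHom R S C N) : bassEval R S C N (BalancedTensor.tmul R c f) = f c := rfl

/-- The left `R`-module `M` belongs to the Auslander class `𝒜_C(R)`. -/
structure InAuslanderClass (M : Type u) [AddCommGroup M] [Module R M] : Prop where
  /-- `Tor_i^R(C, M) = 0` for `i ≥ 1`. -/
  A1 : ∀ i : ℕ, 1 ≤ i → Subsingleton (TorGroup R M C i)
  /-- `Ext^i_S(C, C ⊗_R M) = 0` for `i ≥ 1`. -/
  A2 : ∀ i : ℕ, 1 ≤ i →
    Subsingleton (Abelian.Ext (ModuleCat.of S C) (ModuleCat.of S (BalancedTensor R C M)) i)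
  /-- `μ_M` is an isomorphism. -/
  A3 : Function.Bijective (auslanderEval R S C M)

/-- The left `S`-module `N` belongs to the Bass class `ℬ_C(S)`. -/
structure InBassClass (N : Type u) [AddCommGroup N] [Module S N] : Prop where
  /-- `Ext^i_S(C, N) = 0` for `i ≥ 1`. -/
  B1 : ∀ i : ℕ, 1 ≤ i → Subsingleton (Abelian.Ext (ModuleCat.of S C) (ModuleCat.of S N) i)
  /-- `Tor_i^R(C, Hom_S(C, N)) = 0` for `i ≥ 1`. -/
  B2 : ∀ i : ℕ, 1 ≤ i → Subsingleton (TorGroup R (BimoduleHom R S C N) C i)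
  /-- `ν_N` is an isomorphism. -/
  B3 : Function.Bijective (bassEval R S C N)

end Semidualizing

end

/-! The argument runs over a class of modules containing `C` rather than over `C` alone. Write `K*`
for the dual `Hom(K, C)`. The class `IsTotallyDualizable` contains `C`, because by the homothety
condition the dual of `C` is the other ring, free of rank one. It is also closed under syzygies
(`IsTotallyDualizable.exists_cover`): for `0 → K' → A^n → K → 0` the vanishing of `Ext¹(K, C)` makes
`0 → K* → C^n → K'* → 0` exact, so `K'*` is super finitely presented, being the cokernel of an
injection between such modules.

Let `M` be weak flat. Since `Tor₁(K'*, M) = 0`, the dual sequence stays exact after `- ⊗ M`. It is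
compared with `0 → Hom(K, C ⊗ M) → Hom(S^n, C ⊗ M) → Hom(K', C ⊗ M)` through the natural map
`homTensorEval`, which is bijective on free modules of finite rank. A diagram chase gives
injectivity for all `K` in the class, then surjectivity for `K` from injectivity for `K'`.
Surjectivity for `K'` yields `Ext¹(K, C ⊗ M) = 0`, and dimension shifting gives the higher groups.
For `K = C` one has `K* ⊗ M ≅ M`, and the natural map becomes `μ_M`.

Let `N` be weak injective. Now `Hom(-, N)` preserves exactness of the dual sequence, and the same
chase applies to `tensorHomEval`, with surjectivity first and injectivity second; injectivity for
`K'` yields `Tor₁(K, Hom(C, N)) = 0`. The two remaining conditions, on `Tor(C, M)` and `Ext(C, N)`,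
follow from the definitions by dimension shifting. -/

noncomputable section

/-! ### Resolutions by finitely generated projectives -/

/-- A resolution of `M` by finitely generated projective modules, given by plain linear maps. -/
structure FiniteResolution (A : Type u) [Ring A] (M : Type u) [AddCommGroup M] [Module A M] where
  /-- the terms of the resolution -/
  X : ℕ → ModuleCat.{u} A
  projective : ∀ n, Module.Projective A (X n)
  finite : ∀ n, Module.Finite A (X n)
  /-- the differentials -/
  d : ∀ n, X (n + 1) →ₗ[A] X n
  /-- the augmentation -/
  ε : X 0 →ₗ[A] M
  surjective_ε : Function.Surjective ε
  exact_zero : Function.Exact (d 0) ε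
  exact_succ : ∀ n, Function.Exact (d (n + 1)) (d n)

namespace FiniteResolution

variable {A : Type u} [Ring A] {M : Type u} [AddCommGroup M] [Module A M]

/-- The chain complex underlying a finite resolution. -/
def complex (ρ : FiniteResolution A M) : ChainComplex (ModuleCat.{u} A) ℕ :=
  ChainComplex.of ρ.X (fun n => ModuleCat.ofHom (ρ.d n)) (fun n => by
    ext x
    exact (ρ.exact_succ n).apply_apply_eq_zero x)

theorem complex_d (ρ : FiniteResolution A M) (n : ℕ) :
    ρ.complex.d (n + 1) n = ModuleCat.ofHom (ρ.d n) :=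
  ChainComplex.of_d ρ.X (fun n => ModuleCat.ofHom (ρ.d n)) n

theorem complex_exactAt_succ (ρ : FiniteResolution A M) (n : ℕ) :
    ρ.complex.ExactAt (n + 1) := by
  rw [HomologicalComplex.exactAt_iff' _ (n + 1 + 1) (n + 1) n (by simp) (by simp),
    ShortComplex.ShortExact.moduleCat_exact_iff_function_exact]
  change Function.Exact (ρ.complex.d (n + 1 + 1) (n + 1)) (ρ.complex.d (n + 1) n)
  rw [complex_d, complex_d]
  exact ρ.exact_succ n

/-- The augmentation as a map of complexes. -/
def augmentation (ρ : FiniteResolution A M) :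
    ρ.complex ⟶ (ChainComplex.single₀ (ModuleCat.{u} A)).obj (ModuleCat.of A M) :=
  (ChainComplex.toSingle₀Equiv _ _).symm ⟨ModuleCat.ofHom ρ.ε, by
    rw [ρ.complex_d]
    ext x
    exact ρ.exact_zero.apply_apply_eq_zero x⟩

theorem augmentation_f_zero (ρ : FiniteResolution A M) :
    ρ.augmentation.f 0 = ModuleCat.ofHom ρ.ε :=
  ChainComplex.toSingle₀Equiv_symm_apply_f_zero _ _

theorem quasiIso_augmentation (ρ : FiniteResolution A M) : QuasiIso ρ.augmentation :=
  ⟨fun n => by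
    cases n
    · rw [ChainComplex.quasiIsoAt₀_iff, ShortComplex.quasiIso_iff_of_zeros']
      · have h : (ShortComplex.mk (ModuleCat.ofHom (ρ.d 0)) (ModuleCat.ofHom ρ.ε) (by
            ext x; exact ρ.exact_zero.apply_apply_eq_zero x)).Exact ∧
            Epi (ModuleCat.ofHom ρ.ε) := by
          refine ⟨?_, (ModuleCat.epi_iff_surjective _).2 ρ.surjective_ε⟩
          rw [ShortComplex.ShortExact.moduleCat_exact_iff_function_exact]
          exact ρ.exact_zero
        refine (ShortComplex.exact_and_epi_g_iff_of_iso ?_).2 h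
        -- The objects agree definitionally, but the maps only through `complex_d` and
        -- `augmentation_f_zero`.
        exact ShortComplex.isoMk (Iso.refl _) (Iso.refl _) (Iso.refl _)
          ((Category.id_comp _).trans ((ρ.complex_d 0).symm.trans (Category.comp_id _).symm))
          ((Category.id_comp _).trans
            (ρ.augmentation_f_zero.symm.trans (Category.comp_id (ρ.augmentation.f 0)).symm))
      all_goals rfl
    · rw [quasiIsoAt_iff_exactAt']
      · apply complex_exactAt_succ
      · apply ChainComplex.exactAt_succ_single_obj⟩

/-- The projective resolution given by a finite resolution. -/
def toProjectiveResolution (ρ : FiniteResolution A M) :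
    ProjectiveResolution (ModuleCat.of A M) where
  complex := ρ.complex
  projective n := (IsProjective.iff_projective _).1 (ρ.projective n)
  π := ρ.augmentation
  quasiIso := ρ.quasiIso_augmentation

theorem isSuperFinitelyPresented (ρ : FiniteResolution A M) : IsSuperFinitelyPresented A M :=
  ⟨ρ.toProjectiveResolution, ρ.finite⟩

/-- The finite resolution given by a projective resolution with finitely generated terms. -/
def ofProjectiveResolution (P : ProjectiveResolution (ModuleCat.of A M))
    (hP : ∀ n, Module.Finite A (P.complex.X n)) : FiniteResolution A M where
  X := P.complex.X
  projective n := (IsProjective.iff_projective _).2 (P.projective n)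
  finite := hP
  d n := (P.complex.d (n + 1) n).hom
  ε := (P.π.f 0).hom
  surjective_ε := (ModuleCat.epi_iff_surjective (P.π.f 0)).1 inferInstance
  exact_zero :=
    (ShortComplex.ShortExact.moduleCat_exact_iff_function_exact _).1 P.exact₀
  exact_succ n := (ShortComplex.ShortExact.moduleCat_exact_iff_function_exact _).1 (P.exact_succ n)

/-- The tail of a finite resolution resolves the first syzygy. -/
def tail (ρ : FiniteResolution A M) : FiniteResolution A (LinearMap.ker ρ.ε) where
  X n := ρ.X (n + 1)
  projective n := ρ.projective _
  finite n := ρ.finite _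
  d n := ρ.d _
  ε := (ρ.d 0).codRestrict _ fun x => ρ.exact_zero.apply_apply_eq_zero x
  surjective_ε := fun ⟨x, hx⟩ => by
    obtain ⟨y, rfl⟩ := (ρ.exact_zero x).1 hx
    exact ⟨y, rfl⟩
  exact_zero x := by
    rw [← ρ.exact_succ 0 x, Subtype.ext_iff]
    rfl
  exact_succ n := ρ.exact_succ _

/-- Splicing a finite resolution of the kernel of `p : P → M` with `p`. -/
def cons {P K : Type u} [AddCommGroup P] [Module A P] [AddCommGroup K] [Module A K]
    (hP : Module.Projective A P) (hP' : Module.Finite A P)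
    (i : K →ₗ[A] P) (p : P →ₗ[A] M) (hi : Function.Injective i) (hp : Function.Surjective p)
    (hip : Function.Exact i p) (ρ : FiniteResolution A K) : FiniteResolution A M where
  X n := match n with
    | 0 => ModuleCat.of A P
    | n + 1 => ρ.X n
  projective n := match n with
    | 0 => hP
    | n + 1 => ρ.projective n
  finite n := match n with
    | 0 => hP'
    | n + 1 => ρ.finite n
  d n := match n with
    | 0 => i ∘ₗ ρ.ε
    | n + 1 => ρ.d n
  ε := p
  surjective_ε := hp
  exact_zero x := by
    refine (hip x).trans ⟨?_, ?_⟩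
    · rintro ⟨y, rfl⟩
      obtain ⟨z, rfl⟩ := ρ.surjective_ε y
      exact ⟨z, rfl⟩
    · rintro ⟨z, rfl⟩
      exact ⟨ρ.ε z, rfl⟩
  exact_succ n := match n with
    | 0 => fun x => by
      rw [← ρ.exact_zero x]
      exact map_eq_zero_iff i hi
    | n + 1 => ρ.exact_succ n

end FiniteResolution

/-! ### Resolutions built from successive syzygies -/

section Coinduction

variable {A : Type u} [Ring A]

theorem isSuperFinitelyPresented_iff (M : Type u) [AddCommGroup M] [Module A M] :
    IsSuperFinitelyPresented A M ↔ Nonempty (FiniteResolution A M) :=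
  ⟨fun ⟨P, hP⟩ => ⟨.ofProjectiveResolution P hP⟩, fun ⟨ρ⟩ => ρ.isSuperFinitelyPresented⟩

/-- A class of modules is closed under taking suitable first syzygies. -/
def ClosedUnderSyzygies (X : ModuleCat.{u} A → Prop) : Prop :=
  ∀ M : ModuleCat.{u} A, X M → ∃ (P : ModuleCat.{u} A) (p : P →ₗ[A] M),
    Module.Projective A P ∧ Module.Finite A P ∧ Function.Surjective p ∧
      X (ModuleCat.of A (LinearMap.ker p))

/-- Choosing covers forever gives a sequence of syzygies, and splicing the covers gives a
resolution. Closure properties thus reduce to a check on a single syzygy. -/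
theorem ClosedUnderSyzygies.isSuperFinitelyPresented {X : ModuleCat.{u} A → Prop}
    (hX : ClosedUnderSyzygies X) (M : ModuleCat.{u} A) (hM : X M) :
    IsSuperFinitelyPresented A M := by
  choose P p h₁ h₂ h₃ h₄ using hX
  let next : {M // X M} → {M // X M} := fun M => ⟨_, h₄ M.1 M.2⟩
  -- `Z n` is the `n`-th syzygy. The differentials are the composites `P_{n+1} → Z (n + 1) → P_n`.
  let Z : ℕ → {M // X M} := fun n => n.rec ⟨M, hM⟩ fun _ => next
  let π : ∀ n, P (Z n).1 (Z n).2 →ₗ[A] (Z n).1 := fun n => p (Z n).1 (Z n).2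
  have hπ : ∀ n, Function.Surjective (π n) := fun n => h₃ _ _
  let ι : ∀ n, (Z (n + 1)).1 →ₗ[A] P (Z n).1 (Z n).2 := fun n => (LinearMap.ker (π n)).subtype
  have hι : ∀ n, Function.Injective (ι n) := fun n => Subtype.val_injective
  have hιπ : ∀ n, Function.Exact (ι n) (π n) := fun n => LinearMap.exact_subtype_ker_map _
  have key : ∀ n, Function.Exact (ι n ∘ₗ π (n + 1)) (π n) := fun n x => by
    refine (hιπ n x).trans ⟨?_, ?_⟩
    · rintro ⟨y, rfl⟩
      obtain ⟨z, rfl⟩ := hπ (n + 1) y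
      exact ⟨z, rfl⟩
    · rintro ⟨z, rfl⟩
      exact ⟨π (n + 1) z, rfl⟩
  refine FiniteResolution.isSuperFinitelyPresented
    { X := fun n => P (Z n).1 (Z n).2
      projective := fun n => h₁ _ _
      finite := fun n => h₂ _ _
      d := fun n => ι n ∘ₗ π (n + 1)
      ε := π 0
      surjective_ε := hπ 0
      exact_zero := key 0
      exact_succ := fun n x => ?_ }
  rw [← key (n + 1) x]
  exact map_eq_zero_iff (ι n) (hι n)

end Coinduction

/-! ### Closure properties of super finitely presented modules -/

namespace IsSuperFinitelyPresented

variable {A : Type u} [Ring A] {K E Y M : Type u} [AddCommGroup K] [Module A K]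
  [AddCommGroup E] [Module A E] [AddCommGroup Y] [Module A Y] [AddCommGroup M] [Module A M]

theorem of_finite_projective (hp : Module.Projective A M) (hf : Module.Finite A M) :
    IsSuperFinitelyPresented A M := by
  refine ClosedUnderSyzygies.isSuperFinitelyPresented
    (X := fun M => Module.Projective A M ∧ Module.Finite A M) ?_ (ModuleCat.of A M) ⟨hp, hf⟩
  rintro M ⟨h, h'⟩
  have : Subsingleton (LinearMap.ker (LinearMap.id : M →ₗ[A] M)) := by
    rw [LinearMap.ker_id]; infer_instance
  exact ⟨M, LinearMap.id, h, h', Function.surjective_id, Module.Projective.of_free,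
    Module.Finite.of_finite⟩

theorem of_cover (hp : Module.Projective A E) (hf : Module.Finite A E)
    {i : K →ₗ[A] E} {p : E →ₗ[A] M} (hi : Function.Injective i) (hps : Function.Surjective p)
    (hip : Function.Exact i p) (hK : IsSuperFinitelyPresented A K) :
    IsSuperFinitelyPresented A M := by
  obtain ⟨ρ⟩ := (isSuperFinitelyPresented_iff K).1 hK
  exact (ρ.cons hp hf i p hi hps hip).isSuperFinitelyPresented

theorem exists_cover (hM : IsSuperFinitelyPresented A M) :
    ∃ (P : ModuleCat.{u} A) (p : P →ₗ[A] M), Module.Projective A P ∧ Module.Finite A P ∧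
      Function.Surjective p ∧ IsSuperFinitelyPresented A (LinearMap.ker p) := by
  obtain ⟨ρ⟩ := (isSuperFinitelyPresented_iff M).1 hM
  exact ⟨ρ.X 0, ρ.ε, ρ.projective 0, ρ.finite 0, ρ.surjective_ε, ρ.tail.isSuperFinitelyPresented⟩

theorem of_equiv (e : M ≃ₗ[A] E) (hM : IsSuperFinitelyPresented A M) :
    IsSuperFinitelyPresented A E := by
  obtain ⟨P, p, hP, hP', hp, hK⟩ := hM.exists_cover
  refine of_cover (p := e.toLinearMap ∘ₗ p) hP hP' (LinearMap.ker p).injective_subtype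
    (e.surjective.comp hp) (fun x => ?_) hK
  rw [← LinearMap.exact_subtype_ker_map p x]
  exact e.map_eq_zero_iff

/-- Super finitely presented modules are closed under extensions. -/
theorem of_extension {i : K →ₗ[A] E} {p : E →ₗ[A] Y} (hi : Function.Injective i)
    (hp : Function.Surjective p) (hip : Function.Exact i p) (hK : IsSuperFinitelyPresented A K)
    (hY : IsSuperFinitelyPresented A Y) : IsSuperFinitelyPresented A E := by
  -- The horseshoe construction, one step at a time: the class of all such extensions is closed
  -- under syzygies, since the kernel of `P × Q → E` is an extension of `ker g` by `ker f`.
  refine ClosedUnderSyzygies.isSuperFinitelyPresented (X := fun E : ModuleCat.{u} A =>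
    ∃ (K Y : ModuleCat.{u} A) (i : K →ₗ[A] E) (p : E →ₗ[A] Y), Function.Injective i ∧
      Function.Surjective p ∧ Function.Exact i p ∧ IsSuperFinitelyPresented A K ∧
      IsSuperFinitelyPresented A Y) ?_ (ModuleCat.of A E)
    ⟨.of A K, .of A Y, i, p, hi, hp, hip, hK, hY⟩
  rintro E ⟨K, Y, i, p, hi, hp, hip, hK, hY⟩
  obtain ⟨P, f, hP, hP', hf, hKf⟩ := hK.exists_cover
  obtain ⟨Q, g, hQ, hQ', hg, hKg⟩ := hY.exists_cover
  obtain ⟨l, hl⟩ := Module.projective_lifting_property p g hp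
  have hl' : ∀ y, p (l y) = g y := fun y => LinearMap.congr_fun hl y
  have hpi : ∀ x, p (i x) = 0 := hip.apply_apply_eq_zero
  let q : P × Q →ₗ[A] E := (i ∘ₗ f).coprod l
  have hq : ∀ x y, q (x, y) = i (f x) + l y := fun x y => rfl
  refine ⟨.of A (P × Q), q, inferInstanceAs (Module.Projective A (P × Q)),
    inferInstanceAs (Module.Finite A (P × Q)), fun e => ?_,
    .of A (LinearMap.ker f), .of A (LinearMap.ker g),
    (LinearMap.inl A P Q).restrict fun x hx => ?_,
    (LinearMap.snd A P Q).restrict fun x hx => ?_, ?_, ?_, ?_, hKf, hKg⟩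
  · obtain ⟨y, hy⟩ := hg (p e)
    obtain ⟨k, hk⟩ := (hip (e - l y)).1 (by rw [map_sub, hl', hy, sub_self])
    obtain ⟨x, rfl⟩ := hf k
    exact ⟨(x, y), by rw [hq, hk, sub_add_cancel]⟩
  · change q (x, 0) = 0
    rw [hq, LinearMap.mem_ker.1 hx, map_zero, map_zero, zero_add]
  · have h := congrArg p (show i (f x.1) + l x.2 = 0 from hx)
    rwa [map_add, hpi, zero_add, hl', map_zero] at h
  · rintro ⟨x, hx⟩ ⟨y, hy⟩ h
    exact Subtype.ext (congrArg (fun z => z.1.1) h)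
  · rintro ⟨y, hy⟩
    obtain ⟨k, hk⟩ := (hip (l y)).1 ((hl' y).trans hy)
    obtain ⟨x, rfl⟩ := hf k
    refine ⟨⟨(-x, y), ?_⟩, rfl⟩
    change q (-x, y) = 0
    rw [hq, map_neg, map_neg, hk, neg_add_cancel]
  · rintro ⟨⟨x, y⟩, hxy⟩
    constructor
    · intro h
      obtain rfl : y = 0 := congrArg Subtype.val h
      refine ⟨⟨x, hi ?_⟩, rfl⟩
      have h' : i (f x) + l 0 = 0 := hxy
      rwa [map_zero, add_zero, ← map_zero i] at h'
    · rintro ⟨z, hz⟩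
      exact Subtype.ext (congrArg (fun z => z.1.2) hz).symm

/-- The cokernel of an injective map between super finitely presented modules is super finitely
presented. -/
theorem of_coker {i : K →ₗ[A] E} {p : E →ₗ[A] Y} (hi : Function.Injective i)
    (hp : Function.Surjective p) (hip : Function.Exact i p) (hK : IsSuperFinitelyPresented A K)
    (hE : IsSuperFinitelyPresented A E) : IsSuperFinitelyPresented A Y := by
  obtain ⟨P, f, hP, hP', hf, hKf⟩ := hE.exists_cover
  refine of_cover (p := p ∘ₗ f) hP hP' (LinearMap.ker (p ∘ₗ f)).injective_subtype (hp.comp hf)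
    (LinearMap.exact_subtype_ker_map _) ?_
  -- The map `f` sends `ker (p ∘ f)` onto the image of `i`, with kernel `ker f`; so the new syzygy
  -- is an extension of a copy of `K` by `ker f`.
  have hr : ∀ x : LinearMap.ker (p ∘ₗ f), f x ∈ LinearMap.range i :=
    fun x => (hip _).1 x.2
  let r : LinearMap.ker (p ∘ₗ f) →ₗ[A] LinearMap.range i :=
    (f ∘ₗ Submodule.subtype _).codRestrict _ hr
  refine of_extension (i := Submodule.inclusion (p := LinearMap.ker f) (fun x hx => ?_)) (p := r)
    (Submodule.inclusion_injective _) ?_ ?_ hKf (hK.of_equiv (LinearEquiv.ofInjective i hi))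
  · change p (f x) = 0
    rw [LinearMap.mem_ker.1 hx, map_zero]
  · rintro ⟨_, k, rfl⟩
    obtain ⟨x, hx⟩ := hf (i k)
    exact ⟨⟨x, (congrArg p hx).trans (hip.apply_apply_eq_zero k)⟩, Subtype.ext hx⟩
  · rintro ⟨x, hx⟩
    constructor
    · intro h
      exact ⟨⟨x, congrArg Subtype.val h⟩, rfl⟩
    · rintro ⟨⟨y, hy⟩, h⟩
      obtain rfl : y = x := congrArg Subtype.val h
      exact Subtype.ext hy

/-- Write a finitely generated projective cover as a direct summand of a free module through `g`.
The new kernel is an extension of the old one by `ker g`, itself a summand of the free module. -/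
theorem exists_free_cover (hM : IsSuperFinitelyPresented A M) :
    ∃ (n : ℕ) (p : (Fin n → A) →ₗ[A] M), Function.Surjective p ∧
      IsSuperFinitelyPresented A (LinearMap.ker p) := by
  obtain ⟨P, f, hP, hP', hf, hKf⟩ := hM.exists_cover
  obtain ⟨n, g, s, hg, -, hs⟩ := Module.Finite.exists_comp_eq_id_of_projective A P
  have hgs : ∀ x, g (s x) = x := LinearMap.congr_fun hs
  refine ⟨n, f ∘ₗ g, hf.comp hg, ?_⟩
  let t : (Fin n → A) →ₗ[A] LinearMap.ker g :=
    (LinearMap.id - s ∘ₗ g).codRestrict _ fun x => by simp [hgs]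
  have ht : ∀ x, t x.1 = x := fun ⟨x, hx⟩ => Subtype.ext <| by simp [t, LinearMap.mem_ker.1 hx]
  have hk : IsSuperFinitelyPresented A (LinearMap.ker g) :=
    of_finite_projective (.of_split (LinearMap.ker g).subtype t (LinearMap.ext ht))
      (.of_surjective t fun x => ⟨x, ht x⟩)
  refine of_extension (i := Submodule.inclusion (p := LinearMap.ker g) (fun x hx => ?_))
    (p := (g ∘ₗ Submodule.subtype _).codRestrict (LinearMap.ker f) fun x => x.2)
    (Submodule.inclusion_injective _) ?_ ?_ hk hKf
  · change f (g x) = 0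
    rw [LinearMap.mem_ker.1 hx, map_zero]
  · rintro ⟨x, hx⟩
    obtain ⟨y, rfl⟩ := hg x
    exact ⟨⟨y, hx⟩, rfl⟩
  · rintro ⟨x, hx⟩
    constructor
    · intro h
      exact ⟨⟨x, congrArg Subtype.val h⟩, rfl⟩
    · rintro ⟨⟨y, hy⟩, h⟩
      obtain rfl : y = x := congrArg Subtype.val h
      exact Subtype.ext hy

theorem pi_fin (hM : IsSuperFinitelyPresented A M) (n : ℕ) :
    IsSuperFinitelyPresented A (Fin n → M) := by
  induction n with
  | zero => exact of_finite_projective .of_free .of_finite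
  | succ n ih =>
    refine of_extension (i := LinearMap.inl A M (Fin n → M)) (p := LinearMap.snd A M (Fin n → M))
      LinearMap.inl_injective LinearMap.snd_surjective ?_ hM ih |>.of_equiv
      (Fin.consLinearEquiv A fun _ : Fin (n + 1) => M)
    exact .inl_snd

end IsSuperFinitelyPresented

/-! ### Ext along a short exact sequence -/

section Ext

open Abelian

variable {A : Type u} [Ring A] {K Q L : Type u} [AddCommGroup K] [Module A K]
  [AddCommGroup Q] [Module A Q] [AddCommGroup L] [Module A L] {i : K →ₗ[A] Q} {p : Q →ₗ[A] L}

theorem shortExact_of_function_exact (hi : Function.Injective i) (hp : Function.Surjective p)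
    (hip : Function.Exact i p) :
    (ShortComplex.mk (ModuleCat.ofHom i) (ModuleCat.ofHom p)
      (by ext x; exact hip.apply_apply_eq_zero x)).ShortExact where
  exact := (ShortComplex.ShortExact.moduleCat_exact_iff_function_exact _).2 hip
  mono_f := (ModuleCat.mono_iff_injective _).2 hi
  epi_g := (ModuleCat.epi_iff_surjective _).2 hp

/-- The obstruction to extending `g` is its image under the connecting map to `Ext¹(L, N)`. -/
theorem exists_extension_of_ext_one (hi : Function.Injective i) (hp : Function.Surjective p)
    (hip : Function.Exact i p) {N : Type u} [AddCommGroup N] [Module A N]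
    (h : Subsingleton (Ext (ModuleCat.of A L) (ModuleCat.of A N) 1)) (g : K →ₗ[A] N) :
    ∃ g' : Q →ₗ[A] N, g' ∘ₗ i = g := by
  obtain ⟨x, hx⟩ := Ext.contravariant_sequence_exact₁ (shortExact_of_function_exact hi hp hip)
    (ModuleCat.of A N) (Ext.mk₀ (ModuleCat.ofHom g)) (n₁ := 1) rfl (Subsingleton.elim _ _)
  obtain ⟨y, rfl⟩ := Ext.homEquiv₀.symm.surjective x
  refine ⟨y.hom, ?_⟩
  have h' := (Ext.mk₀_comp_mk₀ (ModuleCat.ofHom i) y).symm.trans hx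
  exact congrArg ModuleCat.Hom.hom (Ext.homEquiv₀.symm.injective h')

/-- As `Q` is projective, each class in `Ext¹(L, N)` comes from some `K → N` by the connecting map,
which kills maps that extend to `Q`. -/
theorem subsingleton_ext_one (hQ : Module.Projective A Q) (hi : Function.Injective i)
    (hp : Function.Surjective p) (hip : Function.Exact i p)
    {N : Type u} [AddCommGroup N] [Module A N]
    (h : ∀ g : K →ₗ[A] N, ∃ g' : Q →ₗ[A] N, g' ∘ₗ i = g) :
    Subsingleton (Ext (ModuleCat.of A L) (ModuleCat.of A N) 1) := by
  have : Projective (ModuleCat.of A Q) := (IsProjective.iff_projective _).1 hQ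
  refine subsingleton_of_forall_eq 0 fun x => ?_
  have hS := shortExact_of_function_exact hi hp hip
  obtain ⟨y, rfl⟩ := Ext.contravariant_sequence_exact₃ hS (ModuleCat.of A N) x
    (Ext.eq_zero_of_projective _) (n₀ := 0) rfl
  obtain ⟨y, rfl⟩ := Ext.homEquiv₀.symm.surjective y
  obtain ⟨g, hg⟩ := h y.hom
  have hy : y = ModuleCat.ofHom i ≫ ModuleCat.ofHom g := by
    ext x; exact (LinearMap.congr_fun hg x).symm
  subst hy
  change hS.extClass.comp (Ext.mk₀ _) _ = 0
  rw [← Ext.mk₀_comp_mk₀]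
  exact hS.extClass_comp_assoc _ 

theorem subsingleton_ext_succ (hQ : Module.Projective A Q) (hi : Function.Injective i)
    (hp : Function.Surjective p) (hip : Function.Exact i p)
    {N : Type u} [AddCommGroup N] [Module A N] {n : ℕ}
    (h : Subsingleton (Ext (ModuleCat.of A K) (ModuleCat.of A N) n)) :
    Subsingleton (Ext (ModuleCat.of A L) (ModuleCat.of A N) (n + 1)) := by
  have : Projective (ModuleCat.of A Q) := (IsProjective.iff_projective _).1 hQ
  refine subsingleton_of_forall_eq 0 fun x => ?_
  obtain ⟨y, rfl⟩ := Ext.contravariant_sequence_exact₃ (shortExact_of_function_exact hi hp hip)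
    (ModuleCat.of A N) x (Ext.eq_zero_of_projective _) (n₀ := n) (add_comm 1 n)
  rw [h.elim y 0, Ext.comp_zero]

/-- Dimension shifting downwards; `1 ≤ n` is what makes `Ext^n(Q, N)` vanish. -/
theorem subsingleton_ext_of_succ (hQ : Module.Projective A Q) (hi : Function.Injective i)
    (hp : Function.Surjective p) (hip : Function.Exact i p)
    {N : Type u} [AddCommGroup N] [Module A N] {n : ℕ} (hn : 1 ≤ n)
    (h : Subsingleton (Ext (ModuleCat.of A L) (ModuleCat.of A N) (n + 1))) :
    Subsingleton (Ext (ModuleCat.of A K) (ModuleCat.of A N) n) := by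
  have : Projective (ModuleCat.of A Q) := (IsProjective.iff_projective _).1 hQ
  refine subsingleton_of_forall_eq 0 fun x => ?_
  obtain ⟨y, rfl⟩ := Ext.contravariant_sequence_exact₁ (shortExact_of_function_exact hi hp hip)
    (ModuleCat.of A N) x (n₁ := n + 1) (add_comm 1 n) (Subsingleton.elim _ _)
  obtain ⟨n, rfl⟩ := Nat.exists_eq_add_of_le' hn
  rw [Ext.eq_zero_of_projective y, Ext.comp_zero]

end Ext

/-! ### Right exactness of the balanced tensor product -/

namespace BalancedTensor

variable {R : Type*} [Ring R] {A A' A'' : Type*} [AddCommGroup A] [Module Rᵐᵒᵖ A]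
  [AddCommGroup A'] [Module Rᵐᵒᵖ A'] [AddCommGroup A''] [Module Rᵐᵒᵖ A'']

section

variable {M : Type*} [AddCommGroup M] [Module R M]

theorem rTensor_comp_apply (g : A' →ₗ[Rᵐᵒᵖ] A'') (f : A →ₗ[Rᵐᵒᵖ] A')
    (x : BalancedTensor R A M) :
    rTensor R M (g ∘ₗ f) x = rTensor R M g (rTensor R M f x) := by
  induction x using induction_on with
  | zero => simp only [map_zero]
  | tmul a m => rfl
  | add x y hx hy => simp only [map_add, hx, hy]

theorem rTensor_id (x : BalancedTensor R A M) : rTensor R M LinearMap.id x = x := by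
  induction x using induction_on with
  | zero => exact map_zero _
  | tmul a m => rfl
  | add x y hx hy => rw [map_add, hx, hy]

theorem zero_tmul (m : M) : tmul R (0 : A) m = 0 :=
  DFunLike.congr_fun (map_zero (mk R A M)) m

theorem rTensor_zero (x : BalancedTensor R A M) :
    rTensor R M (0 : A →ₗ[Rᵐᵒᵖ] A') x = 0 := by
  induction x using induction_on with
  | zero => exact map_zero _
  | tmul a m => exact zero_tmul m
  | add x y hx hy => rw [map_add, hx, hy, add_zero]

theorem sum_tmul {ι : Type*} (s : Finset ι) (a : ι → A) (m : M) :
    tmul R (∑ j ∈ s, a j) m = ∑ j ∈ s, tmul R (a j) m :=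
  map_sum ((mk R A M).flip m) a s

end

variable (M : Type*) [AddCommGroup M] [Module R M]

theorem rTensor_surjective {p : A →ₗ[Rᵐᵒᵖ] A'} (hp : Function.Surjective p) :
    Function.Surjective (rTensor R M p) := by
  intro x
  induction x using induction_on with
  | zero => exact ⟨0, map_zero _⟩
  | tmul a m =>
    obtain ⟨b, rfl⟩ := hp a
    exact ⟨tmul R b m, rfl⟩
  | add x y hx hy =>
    obtain ⟨x', rfl⟩ := hx
    obtain ⟨y', rfl⟩ := hy
    exact ⟨x' + y', map_add _ _ _⟩

/-- The functor `- ⊗_R M` is right exact. -/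
theorem rTensor_exact {i : A →ₗ[Rᵐᵒᵖ] A'} {p : A' →ₗ[Rᵐᵒᵖ] A''} (hp : Function.Surjective p)
    (hip : Function.Exact i p) : Function.Exact (rTensor R M i) (rTensor R M p) := by
  let I := (rTensor R M i).range
  let π := QuotientAddGroup.mk' I
  -- Modulo the image of `i ⊗ M`, the class of `a ⊗ m` depends only on `p a`. A merely set-theoretic
  -- section of `p` therefore defines a map `l` from `A'' ⊗ M` to the cokernel whose composite with
  -- `p ⊗ M` is the projection `π`.
  have hπ : ∀ a b m, p a = p b → π (tmul R a m) = π (tmul R b m) := fun a b m h => by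
    obtain ⟨c, hc⟩ := (hip (a - b)).1 (by rw [map_sub, h, sub_self])
    rw [← sub_eq_zero, ← map_sub]
    refine (QuotientAddGroup.eq_zero_iff _).2 ⟨tmul R c m, ?_⟩
    rw [rTensor_tmul, hc]
    exact DFunLike.congr_fun (map_sub (mk R A' M) a b) m
  let s := Function.surjInv hp
  have hs : ∀ a, p (s a) = a := Function.surjInv_eq hp
  let φ : A'' →+ M →+ BalancedTensor R A' M ⧸ I := AddMonoidHom.mk'
    (fun a => π.comp (mk R A' M (s a))) fun a b => AddMonoidHom.ext fun m => by
      refine (hπ _ (s a + s b) m (by simp only [map_add, hs])).trans ?_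
      rw [add_tmul, map_add]
      rfl
  have hφ : ∀ a m, φ a m = π (tmul R (s a) m) := fun a m => rfl
  let l := lift R φ fun a r m => by
    rw [hφ, hφ, ← smul_tmul]
    exact hπ _ _ m (by simp only [map_smul, hs])
  have hl : ∀ x, l (rTensor R M p x) = π x := fun x => by
    induction x using induction_on with
    | zero => simp only [map_zero]
    | tmul a m => exact hπ _ _ m (hs _)
    | add x y hx hy => simp only [map_add, hx, hy]
  intro x
  constructor
  · intro hx
    have h := hl x
    rw [hx, map_zero] at h
    exact (QuotientAddGroup.eq_zero_iff x).1 h.symm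
  · rintro ⟨y, rfl⟩
    rw [← rTensor_comp_apply, hip.linearMap_comp_eq_zero, rTensor_zero]

end BalancedTensor

/-! ### Tor computed from finite resolutions -/

section Tor

open BalancedTensor

variable {R : Type u} [Ring R] {M : Type u} [AddCommGroup M] [Module R M]
  {K Q L : Type u} [AddCommGroup K] [Module Rᵐᵒᵖ K] [AddCommGroup Q] [Module Rᵐᵒᵖ Q]
  [AddCommGroup L] [Module Rᵐᵒᵖ L] {i : K →ₗ[Rᵐᵒᵖ] Q} {p : Q →ₗ[Rᵐᵒᵖ] L}

theorem FiniteResolution.subsingleton_torGroup_succ_iff (ρ : FiniteResolution Rᵐᵒᵖ L) (n : ℕ) :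
    Subsingleton (TorGroup R M L (n + 1)) ↔
      Function.Exact (rTensor R M (ρ.d (n + 1))) (rTensor R M (ρ.d n)) := by
  let F := tensorRightFunctor R M
  let D := (F.mapHomologicalComplex (ComplexShape.down ℕ)).obj ρ.complex
  have e : TorGroup R M L (n + 1) ≅ D.homology (n + 1) :=
    ρ.toProjectiveResolution.isoLeftDerivedObj F (n + 1)
  rw [← AddCommGrpCat.isZero_iff_subsingleton, e.isZero_iff,
    ← HomologicalComplex.exactAt_iff_isZero_homology,
    HomologicalComplex.exactAt_iff' _ (n + 1 + 1) (n + 1) n (by simp) (by simp),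
    ShortComplex.ab_exact_iff_function_exact]
  change Function.Exact (F.map (ρ.complex.d (n + 1 + 1) (n + 1)))
    (F.map (ρ.complex.d (n + 1) n)) ↔ _
  rw [ρ.complex_d, ρ.complex_d]
  rfl

/-- This part of the long exact sequence is obtained by comparison with a resolution of `L`: lifting
`ε` to `Q` presents `Q` as the pushout of `K` and `ρ.X 0` along `ker ε`, and right exactness then
suffices. -/
theorem rTensor_injective_of_tor_one (hi : Function.Injective i) (hp : Function.Surjective p)
    (hip : Function.Exact i p) (hL : IsSuperFinitelyPresented Rᵐᵒᵖ L)
    (h : Subsingleton (TorGroup R M L 1)) : Function.Injective (rTensor R M i) := by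
  obtain ⟨ρ⟩ := (isSuperFinitelyPresented_iff L).1 hL
  have hρ := (ρ.subsingleton_torGroup_succ_iff 0).1 h
  let j := (LinearMap.ker ρ.ε).subtype
  -- Vanishing of `Tor₁(L, M)` says that `ker ε ⊗ M → ρ.X 0 ⊗ M` is injective.
  have hj : ∀ z, rTensor R M j z = 0 → z = 0 := fun z hz => by
    obtain ⟨y, rfl⟩ := rTensor_surjective M ρ.tail.surjective_ε z
    have hd : ρ.d 0 = j ∘ₗ ρ.tail.ε := rfl
    rw [← rTensor_comp_apply, ← hd] at hz
    obtain ⟨x, rfl⟩ := (hρ y).1 hz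
    exact (rTensor_exact M ρ.tail.surjective_ε ρ.tail.exact_zero).apply_apply_eq_zero x
  have := ρ.projective 0
  obtain ⟨l, hl⟩ := Module.projective_lifting_property p ρ.ε hp
  have hl' : ∀ y, p (l y) = ρ.ε y := fun y => LinearMap.congr_fun hl y
  have hk : ∀ z : LinearMap.ker ρ.ε, ∃ y, i y = l z := fun z =>
    (hip (l z)).1 ((hl' z).trans z.2)
  let e := LinearEquiv.ofInjective i hi
  let k : LinearMap.ker ρ.ε →ₗ[Rᵐᵒᵖ] K :=
    e.symm.toLinearMap ∘ₗ (l ∘ₗ j).codRestrict (LinearMap.range i) hk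
  have hik : ∀ z, i (k z) = l z := fun z =>
    congrArg Subtype.val (e.apply_symm_apply ((l ∘ₗ j).codRestrict (LinearMap.range i) hk z))
  let f : LinearMap.ker ρ.ε →ₗ[Rᵐᵒᵖ] K × ρ.X 0 := (-k).prod j
  let g : K × ρ.X 0 →ₗ[Rᵐᵒᵖ] Q := i.coprod l
  have hg : Function.Surjective g := fun q => by
    obtain ⟨x, hx⟩ := ρ.surjective_ε (p q)
    obtain ⟨y, hy⟩ := (hip (q - l x)).1 (by rw [map_sub, hl', hx, sub_self])
    exact ⟨(y, x), by rw [LinearMap.coprod_apply, hy, sub_add_cancel]⟩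
  have hfg : Function.Exact f g := by
    rintro ⟨y, x⟩
    constructor
    · intro h
      have h' : i y + l x = 0 := h
      have hx : ρ.ε x = 0 := by
        have := congrArg p h'
        rwa [map_add, hip.apply_apply_eq_zero, zero_add, hl', map_zero] at this
      refine ⟨⟨x, hx⟩, Prod.ext (hi ?_) rfl⟩
      change i (-k ⟨x, hx⟩) = i y
      rw [map_neg, hik, eq_neg_of_add_eq_zero_left h']
    · rintro ⟨z, hz⟩
      rw [← hz]
      change i (-k z) + l z = 0
      rw [map_neg, hik, neg_add_cancel]
  refine (injective_iff_map_eq_zero _).2 fun x hx => ?_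
  -- The element `(x, 0)` dies in `Q ⊗ M`, so it comes from some `z` in `ker ε ⊗ M`. The second
  -- coordinate forces `z = 0`, and then the first gives `x = 0`.
  obtain ⟨z, hz⟩ := (rTensor_exact M hg hfg (rTensor R M (LinearMap.inl Rᵐᵒᵖ K (ρ.X 0)) x)).1 (by
    rw [← rTensor_comp_apply, LinearMap.coprod_inl, hx])
  have h₂ := congrArg (rTensor R M (LinearMap.snd Rᵐᵒᵖ K (ρ.X 0))) hz
  have h₁ := congrArg (rTensor R M (LinearMap.fst Rᵐᵒᵖ K (ρ.X 0))) hz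
  rw [← rTensor_comp_apply, ← rTensor_comp_apply] at h₁ h₂
  have hz0 : z = 0 := hj z (h₂.trans (by rw [LinearMap.snd_comp_inl, rTensor_zero]))
  rw [hz0, map_zero, LinearMap.fst_comp_inl, rTensor_id] at h₁
  exact h₁.symm

/-- Splice a resolution of `K` with `Q`. Since `i ⊗ M` is injective, the kernel of the first spliced
differential after tensoring is that of `ε ⊗ M`. -/
theorem subsingleton_torGroup_one (hQ : Module.Projective Rᵐᵒᵖ Q) (hQ' : Module.Finite Rᵐᵒᵖ Q)
    (hi : Function.Injective i) (hp : Function.Surjective p) (hip : Function.Exact i p)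
    (hK : IsSuperFinitelyPresented Rᵐᵒᵖ K) (h : Function.Injective (rTensor R M i)) :
    Subsingleton (TorGroup R M L 1) := by
  obtain ⟨ρ⟩ := (isSuperFinitelyPresented_iff K).1 hK
  refine ((ρ.cons hQ hQ' i p hi hp hip).subsingleton_torGroup_succ_iff 0).2 fun x => ?_
  refine Iff.trans ?_ (rTensor_exact M ρ.surjective_ε ρ.exact_zero x)
  refine Iff.trans ?_ (map_eq_zero_iff _ h)
  exact (rTensor_comp_apply i ρ.ε x).congr_left

/-- The spliced resolution of `L` is that of `K` moved up by one degree. -/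
theorem subsingleton_torGroup_succ (hQ : Module.Projective Rᵐᵒᵖ Q)
    (hQ' : Module.Finite Rᵐᵒᵖ Q) (hi : Function.Injective i) (hp : Function.Surjective p)
    (hip : Function.Exact i p) (hK : IsSuperFinitelyPresented Rᵐᵒᵖ K) {n : ℕ} (hn : 1 ≤ n)
    (h : Subsingleton (TorGroup R M K n)) : Subsingleton (TorGroup R M L (n + 1)) := by
  obtain ⟨ρ⟩ := (isSuperFinitelyPresented_iff K).1 hK
  obtain ⟨n, rfl⟩ := Nat.exists_eq_add_of_le' hn
  exact ((ρ.cons hQ hQ' i p hi hp hip).subsingleton_torGroup_succ_iff (n + 1)).2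
    ((ρ.subsingleton_torGroup_succ_iff n).1 h)

end Tor

/-! ### Exactness of the dual `Hom(-, C)` -/

section HomDual

open Abelian

variable {A : Type u} (B : Type*) (C : Type u) [Ring A] [Ring B] [AddCommGroup C] [Module A C]
  [Module B C] [SMulCommClass A B C]

variable {K Q L : Type u} [AddCommGroup K] [Module A K] [AddCommGroup Q] [Module A Q]
  [AddCommGroup L] [Module A L] {i : K →ₗ[A] Q} {p : Q →ₗ[A] L}

theorem lcomp_injective (hp : Function.Surjective p) : Function.Injective (p.lcomp B C) :=
  fun _ _ h => LinearMap.ext fun x => by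
    obtain ⟨y, rfl⟩ := hp x
    exact LinearMap.congr_fun h y

theorem lcomp_exact (hp : Function.Surjective p) (hip : Function.Exact i p) :
    Function.Exact (p.lcomp B C) (i.lcomp B C) := by
  intro f
  constructor
  · intro hf
    have h : LinearMap.ker p ≤ LinearMap.ker f := fun x hx => by
      obtain ⟨y, rfl⟩ := (hip x).1 hx
      exact LinearMap.congr_fun hf y
    refine ⟨(LinearMap.ker p).liftQ f h ∘ₗ (p.quotKerEquivOfSurjective hp).symm.toLinearMap,
      LinearMap.ext fun x => ?_⟩
    have hx : (p.quotKerEquivOfSurjective hp).symm (p x) = Submodule.Quotient.mk x := by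
      rw [LinearEquiv.symm_apply_eq]
      rfl
    change (LinearMap.ker p).liftQ f h ((p.quotKerEquivOfSurjective hp).symm (p x)) = f x
    rw [hx]
    rfl
  · rintro ⟨g, rfl⟩
    exact LinearMap.ext fun x => (congrArg g (hip.apply_apply_eq_zero x)).trans (map_zero g)

theorem lcomp_surjective (hi : Function.Injective i) (hp : Function.Surjective p)
    (hip : Function.Exact i p)
    (h : Subsingleton (Ext (ModuleCat.of A L) (ModuleCat.of A C) 1)) :
    Function.Surjective (i.lcomp B C) := fun g => exists_extension_of_ext_one hi hp hip h g

end HomDual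

/-! ### The syzygy-closed class containing `C` -/

section DualizingModule

open Abelian

variable (A B C : Type u) [Ring A] [Ring B] [AddCommGroup C] [Module A C] [Module B C]
  [SMulCommClass A B C]

/-- A super finitely presented `A`-module `K` with `Ext^i_A(K, C) = 0` for `i ≥ 1` whose dual
`Hom_A(K, C)` is a super finitely presented `B`-module. -/
structure IsTotallyDualizable (K : Type u) [AddCommGroup K] [Module A K] : Prop where
  isSuperFinitelyPresented : IsSuperFinitelyPresented A K
  ext : ∀ i : ℕ, 1 ≤ i → Subsingleton (Ext (ModuleCat.of A K) (ModuleCat.of A C) i)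
  dual : IsSuperFinitelyPresented B (K →ₗ[A] C)

variable {A B C}

/-- The Ext condition passes to the kernel by dimension shifting. Its dual is the cokernel of `K* →
(A^n)* ≅ C^n`, where `Ext¹(K, C) = 0` gives surjectivity onto it. -/
theorem IsTotallyDualizable.exists_cover (hC : IsSuperFinitelyPresented B C) {K : Type u}
    [AddCommGroup K] [Module A K] (hK : IsTotallyDualizable A B C K) :
    ∃ (n : ℕ) (p : (Fin n → A) →ₗ[A] K), Function.Surjective p ∧
      IsTotallyDualizable A B C (LinearMap.ker p) := by
  obtain ⟨n, p, hp, hk⟩ := hK.isSuperFinitelyPresented.exists_free_cover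
  have hip := LinearMap.exact_subtype_ker_map p
  have hi := (LinearMap.ker p).injective_subtype
  refine ⟨n, p, hp, hk, fun i hi' => ?_, ?_⟩
  · exact subsingleton_ext_of_succ .of_free hi hp hip hi' (hK.ext (i + 1) (by lia))
  · refine .of_coker (lcomp_injective B C hp) (lcomp_surjective B C hi hp hip (hK.ext 1 le_rfl))
      (lcomp_exact B C hp hip) hK.dual ?_
    exact (hC.pi_fin n).of_equiv (LinearEquiv.piRing A C (Fin n) B).symm

theorem isTotallyDualizable_self (hC : IsSuperFinitelyPresented A C)
    (hext : ∀ i : ℕ, 1 ≤ i → Subsingleton (Ext (ModuleCat.of A C) (ModuleCat.of A C) i))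
    (e : B ≃ₗ[B] (C →ₗ[A] C)) : IsTotallyDualizable A B C C :=
  ⟨hC, hext, (IsSuperFinitelyPresented.of_finite_projective .of_free inferInstance).of_equiv e⟩

variable (A B C) in
/-- The homothety map `B → Hom_A(C, C)`. -/
def homothety : B →ₗ[B] (C →ₗ[A] C) where
  toFun b := b • LinearMap.id
  map_add' b b' := add_smul b b' _
  map_smul' b b' := mul_smul b b' _

end DualizingModule

/-! ### Weak flat modules and the Auslander class -/

section Auslander

open Abelian BalancedTensor

variable {R S C : Type u} [Ring R] [Ring S] [AddCommGroup C] [Module S C]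
  [Module Rᵐᵒᵖ C] [SMulCommClass S Rᵐᵒᵖ C] {M : Type u} [AddCommGroup M] [Module R M]

variable (R C M) in
/-- The natural map `Hom_S(K, C) ⊗_R M → Hom_S(K, C ⊗_R M)`. -/
def homTensorEval (K : Type u) [AddCommGroup K] [Module S K] :
    BalancedTensor R (K →ₗ[S] C) M →+ (K →ₗ[S] BalancedTensor R C M) :=
  lift R
    (AddMonoidHom.mk' (fun f => AddMonoidHom.mk' (fun m =>
        { toFun := fun k => tmul R (f k) m
          map_add' := fun k k' => by rw [map_add, add_tmul]
          map_smul' := fun s k => by rw [map_smul]; rfl })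
        fun m m' => LinearMap.ext fun k => tmul_add R (f k) m m')
      fun f f' => AddMonoidHom.ext fun m => LinearMap.ext fun k => add_tmul R (f k) (f' k) m)
    fun f r m => LinearMap.ext fun k => smul_tmul R (f k) r m

@[simp] theorem homTensorEval_tmul {K : Type u} [AddCommGroup K] [Module S K] (f : K →ₗ[S] C)
    (m : M) (k : K) : homTensorEval R C M K (tmul R f m) k = tmul R (f k) m := rfl

theorem homTensorEval_rTensor_lcomp {K L : Type u} [AddCommGroup K] [Module S K]
    [AddCommGroup L] [Module S L] (p : K →ₗ[S] L) (x : BalancedTensor R (L →ₗ[S] C) M) :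
    homTensorEval R C M K (rTensor R M (p.lcomp Rᵐᵒᵖ C) x) = homTensorEval R C M L x ∘ₗ p := by
  induction x using induction_on with
  | zero => simp only [map_zero, LinearMap.zero_comp]
  | tmul f m => rfl
  | add x y hx hy => simp only [map_add, hx, hy, LinearMap.add_comp]

/-- Both sides are `(C ⊗ M)^n`. The inverse sends `h` to the sum of the images of `h(e_j)` under `ψ
j ⊗ M`, where `ψ j` is the `j`-th inclusion of `C` in the dual `C^n` of `S^n`. -/
theorem homTensorEval_bijective_of_free (n : ℕ) :
    Function.Bijective (homTensorEval (S := S) R C M (Fin n → S)) := by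
  let ψ : Fin n → C →ₗ[Rᵐᵒᵖ] ((Fin n → S) →ₗ[S] C) := fun j =>
    { toFun := fun c => LinearMap.toSpanSingleton S C c ∘ₗ LinearMap.proj j
      map_add' := fun c c' => LinearMap.ext fun q => smul_add (q j) c c'
      map_smul' := fun r c => LinearMap.ext fun q => smul_comm (q j) r c }
  have hψ : ∀ j c q, ψ j c q = q j • c := fun j c q => rfl
  have h₁ : ∀ j x q, homTensorEval R C M _ (rTensor R M (ψ j) x) q = q j • x := fun j x q => by
    induction x using induction_on with
    | zero => simp only [map_zero, LinearMap.zero_apply, smul_zero]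
    | tmul c m => rfl
    | add x y hx hy => simp only [map_add, LinearMap.add_apply, hx, hy, smul_add]
  have hsum : ∀ q : Fin n → S, ∑ j, q j • (Pi.single j 1 : Fin n → S) = q := fun q => by
    simpa using (Pi.basisFun S (Fin n)).sum_repr q
  refine Function.bijective_iff_has_inverse.2
    ⟨fun h => ∑ j, rTensor R M (ψ j) (h (Pi.single j 1)), fun x => ?_, fun h => ?_⟩
  · induction x using induction_on with
    | zero => simp
    | tmul f m =>
      simp only [homTensorEval_tmul, rTensor_tmul]
      rw [← sum_tmul]
      congr 1
      refine LinearMap.ext fun q => ?_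
      rw [LinearMap.sum_apply]
      simp only [hψ, ← map_smul, ← map_sum, hsum]
    | add x y hx hy =>
      simp only [map_add, LinearMap.add_apply, Finset.sum_add_distrib] at hx hy ⊢
      rw [hx, hy]
  · refine LinearMap.ext fun q => ?_
    rw [map_sum, LinearMap.sum_apply]
    simp only [h₁, ← map_smul, ← map_sum, hsum]

section

variable (hR : IsSuperFinitelyPresented Rᵐᵒᵖ C) (hM : IsWeakFlat R M)
  {K : Type u} [AddCommGroup K] [Module S K]

include hR hM

/-- `K* ⊗ M` embeds in `(S^n)* ⊗ M` because the cokernel `K'*` of `K* → (S^n)*` has `Tor₁(K'*, M) =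
0`; on the free module the natural map is injective. -/
theorem homTensorEval_injective (hK : IsTotallyDualizable S Rᵐᵒᵖ C K) :
    Function.Injective (homTensorEval (S := S) R C M K) := by
  obtain ⟨n, p, hp, hk⟩ := hK.exists_cover hR
  refine (injective_iff_map_eq_zero _).2 fun x hx => ?_
  have h := homTensorEval_rTensor_lcomp p x
  rw [hx, LinearMap.zero_comp] at h
  have h' := (injective_iff_map_eq_zero _).1 (homTensorEval_bijective_of_free n).1 _ h
  exact (injective_iff_map_eq_zero _).1 (rTensor_injective_of_tor_one
    (lcomp_injective Rᵐᵒᵖ C hp) (lcomp_surjective Rᵐᵒᵖ C (LinearMap.ker p).injective_subtype hp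
      (LinearMap.exact_subtype_ker_map p) (hK.ext 1 le_rfl))
    (lcomp_exact Rᵐᵒᵖ C hp (LinearMap.exact_subtype_ker_map p)) hk.dual (hM _ hk.dual)) x h'

theorem homTensorEval_surjective (hK : IsTotallyDualizable S Rᵐᵒᵖ C K) :
    Function.Surjective (homTensorEval (S := S) R C M K) := by
  obtain ⟨n, p, hp, hk⟩ := hK.exists_cover hR
  have hip := LinearMap.exact_subtype_ker_map p
  intro g
  obtain ⟨x, hx⟩ := (homTensorEval_bijective_of_free n).2 (g ∘ₗ p)
  -- The map `g ∘ p` vanishes on `ker p`, so injectivity for the syzygy kills the restriction of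
  -- `x`, and `x` comes from `K* ⊗ M`.
  have hx0 : rTensor R M ((LinearMap.ker p).subtype.lcomp Rᵐᵒᵖ C) x = 0 := by
    refine (injective_iff_map_eq_zero _).1 (homTensorEval_injective hR hM hk) _ ?_
    rw [homTensorEval_rTensor_lcomp, hx, LinearMap.comp_assoc, hip.linearMap_comp_eq_zero,
      LinearMap.comp_zero]
  obtain ⟨y, rfl⟩ := (rTensor_exact M (lcomp_surjective Rᵐᵒᵖ C
    (LinearMap.ker p).injective_subtype hp hip (hK.ext 1 le_rfl))
    (lcomp_exact Rᵐᵒᵖ C hp hip) x).1 hx0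
  refine ⟨y, LinearMap.ext fun k => ?_⟩
  obtain ⟨q, rfl⟩ := hp k
  rw [homTensorEval_rTensor_lcomp] at hx
  exact LinearMap.congr_fun hx q

theorem subsingleton_ext_balancedTensor (i : ℕ) (hi : 1 ≤ i)
    (hK : IsTotallyDualizable S Rᵐᵒᵖ C K) :
    Subsingleton (Ext (ModuleCat.of S K) (ModuleCat.of S (BalancedTensor R C M)) i) := by
  induction i, hi using Nat.le_induction generalizing K with
  | base =>
    obtain ⟨n, p, hp, hk⟩ := hK.exists_cover hR
    have hip := LinearMap.exact_subtype_ker_map p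
    refine subsingleton_ext_one .of_free (LinearMap.ker p).injective_subtype hp hip fun g => ?_
    -- A map on the syzygy comes from `K'* ⊗ M`, which is a quotient of `(S^n)* ⊗ M`; a preimage
    -- there provides the extension to `S^n`.
    obtain ⟨x, rfl⟩ := homTensorEval_surjective hR hM hk g
    obtain ⟨y, rfl⟩ := rTensor_surjective M (lcomp_surjective Rᵐᵒᵖ C
      (LinearMap.ker p).injective_subtype hp hip (hK.ext 1 le_rfl)) x
    exact ⟨_, (homTensorEval_rTensor_lcomp _ y).symm⟩
  | succ i hi ih =>
    obtain ⟨n, p, hp, hk⟩ := hK.exists_cover hR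
    exact subsingleton_ext_succ .of_free (LinearMap.ker p).injective_subtype hp
      (LinearMap.exact_subtype_ker_map p) (ih hk)

end

theorem IsWeakFlat.subsingleton_torGroup (hM : IsWeakFlat R M) (i : ℕ) (hi : 1 ≤ i)
    {F : Type u} [AddCommGroup F] [Module Rᵐᵒᵖ F] (hF : IsSuperFinitelyPresented Rᵐᵒᵖ F) :
    Subsingleton (TorGroup R M F i) := by
  induction i, hi using Nat.le_induction generalizing F with
  | base => exact hM F hF
  | succ i hi ih =>
    obtain ⟨P, p, hP, hP', hp, hk⟩ := hF.exists_cover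
    exact subsingleton_torGroup_succ hP hP' (LinearMap.ker p).injective_subtype hp
      (LinearMap.exact_subtype_ker_map p) hk hi (ih hk)

/-- The homothety isomorphism identifies `Hom_S(C, C) ⊗ M` with `R ⊗ M`. The inverse sends `f ⊗ m`
to `r m`, where `f` is right multiplication by `r`. -/
theorem tmul_id_bijective (hb : Function.Bijective (fun r : R => rightHomothety S C r)) :
    Function.Bijective fun m : M => tmul R (LinearMap.id : C →ₗ[S] C) m := by
  let e := Equiv.ofBijective _ hb
  have he : ∀ f c, f c = MulOpposite.op (e.symm f) • c := fun f c =>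
    (LinearMap.congr_fun (e.apply_symm_apply f) c).symm
  have he' : ∀ f r, rightHomothety S C r = f → e.symm f = r := fun f r h =>
    e.symm_apply_eq.2 h.symm
  let l : BalancedTensor R (C →ₗ[S] C) M →+ M := lift R
    (AddMonoidHom.mk' (fun f => AddMonoidHom.mk' (fun m => e.symm f • m) (smul_add _))
      fun f g => AddMonoidHom.ext fun m => by
        change e.symm (f + g) • m = e.symm f • m + e.symm g • m
        rw [← add_smul, he' (f + g) (e.symm f + e.symm g)]
        ext c
        rw [LinearMap.add_apply, he f, he g, ← add_smul]
        rfl)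
    fun f r m => by
      change e.symm (MulOpposite.op r • f) • m = e.symm f • r • m
      rw [← mul_smul, he' (MulOpposite.op r • f) (e.symm f * r)]
      ext c
      rw [LinearMap.smul_apply, he f, ← mul_smul]
      rfl
  refine Function.bijective_iff_has_inverse.2 ⟨l, fun m => ?_, fun x => ?_⟩
  · change e.symm LinearMap.id • m = m
    rw [he' LinearMap.id 1 (LinearMap.ext fun c => one_smul Rᵐᵒᵖ c), one_smul]
  · induction x using induction_on with
    | zero => exact (congrArg _ (map_zero l)).trans (map_zero (mk R _ M LinearMap.id))
    | tmul f m =>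
      change tmul R LinearMap.id (e.symm f • m) = tmul R f m
      rw [← smul_tmul]
      congr 1
      exact LinearMap.ext fun c => (he f c).symm
    | add x y hx hy =>
      dsimp only at hx hy ⊢
      rw [map_add, tmul_add, hx, hy]

end Auslander

/-- The identity is a free generator of `Hom_T(C, C)` over `S`. -/
theorem eval_id_bijective {S T C N : Type*} [Ring S] [Ring T] [AddCommGroup C]
    [Module S C] [Module T C] [SMulCommClass T S C] [AddCommGroup N] [Module S N]
    (e : S ≃ₗ[S] (C →ₗ[T] C)) (he : e 1 = LinearMap.id) :
    Function.Bijective fun g : (C →ₗ[T] C) →ₗ[S] N => g LinearMap.id := by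
  refine ⟨fun g g' h => ?_, fun n => ⟨LinearMap.toSpanSingleton S N n ∘ₗ e.symm.toLinearMap, ?_⟩⟩
  · ext f
    obtain ⟨s, rfl⟩ := e.surjective f
    rw [← mul_one s, ← smul_eq_mul, map_smul, he, map_smul, map_smul]
    exact congrArg (s • ·) h
  · change e.symm LinearMap.id • n = n
    rw [← he, e.symm_apply_apply, one_smul]

/-! ### Weak injective modules and the Bass class -/

section Bass

open Abelian BalancedTensor

variable {R S C : Type u} [Ring R] [Ring S] [AddCommGroup C] [Module S C]
  [Module Rᵐᵒᵖ C] [SMulCommClass S Rᵐᵒᵖ C] [SMulCommClass Rᵐᵒᵖ S C]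
  {N : Type u} [AddCommGroup N] [Module S N]

variable (S C N) in
/-- The natural map `K ⊗_R Hom_S(C, N) → Hom_S(Hom_{Rᵒᵖ}(K, C), N)`. -/
def tensorHomEval (K : Type u) [AddCommGroup K] [Module Rᵐᵒᵖ K] :
    BalancedTensor R K (BimoduleHom R S C N) →+ ((K →ₗ[Rᵐᵒᵖ] C) →ₗ[S] N) :=
  lift R
    (AddMonoidHom.mk' (fun k => AddMonoidHom.mk' (fun f =>
        { toFun := fun g => f (g k)
          map_add' := fun g g' => map_add f (g k) (g' k)
          map_smul' := fun s g => map_smul f s (g k) })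
        fun f f' => LinearMap.ext fun g => BimoduleHom.add_apply R S C N f f' (g k))
      fun k k' => AddMonoidHom.ext fun f => LinearMap.ext fun g =>
        (congrArg f (map_add g k k')).trans (map_add f (g k) (g k')))
    fun k r f => LinearMap.ext fun g => congrArg f (map_smul g (MulOpposite.op r) k)

@[simp] theorem tensorHomEval_tmul {K : Type u} [AddCommGroup K] [Module Rᵐᵒᵖ K] (k : K)
    (f : BimoduleHom R S C N) (g : K →ₗ[Rᵐᵒᵖ] C) :
    tensorHomEval S C N K (tmul R k f) g = f (g k) := rfl

theorem tensorHomEval_rTensor {K L : Type u} [AddCommGroup K] [Module Rᵐᵒᵖ K]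
    [AddCommGroup L] [Module Rᵐᵒᵖ L] (p : K →ₗ[Rᵐᵒᵖ] L)
    (x : BalancedTensor R K (BimoduleHom R S C N)) :
    tensorHomEval S C N L (rTensor R _ p x) = tensorHomEval S C N K x ∘ₗ p.lcomp S C := by
  induction x using induction_on with
  | zero => simp only [map_zero, LinearMap.zero_comp]
  | tmul f m => rfl
  | add x y hx hy => simp only [map_add, hx, hy, LinearMap.add_comp]

/-- Both sides are `Hom_S(C, N)^n`; the coordinates of `h` are its restrictions along the inclusions
`ψ j` of `C` in the dual. -/
theorem tensorHomEval_bijective_of_free (n : ℕ) :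
    Function.Bijective (tensorHomEval (R := R) S C N (Fin n → Rᵐᵒᵖ)) := by
  let ψ : Fin n → C →ₗ[S] ((Fin n → Rᵐᵒᵖ) →ₗ[Rᵐᵒᵖ] C) := fun j =>
    { toFun := fun c => LinearMap.toSpanSingleton Rᵐᵒᵖ C c ∘ₗ LinearMap.proj j
      map_add' := fun c c' => LinearMap.ext fun q => smul_add (q j) c c'
      map_smul' := fun r c => LinearMap.ext fun q => smul_comm (q j) r c }
  have hψ : ∀ j c q, ψ j c q = q j • c := fun j c q => rfl
  let φ : ((((Fin n → Rᵐᵒᵖ) →ₗ[Rᵐᵒᵖ] C) →ₗ[S] N)) → Fin n → BimoduleHom R S C N :=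
    fun h j => h ∘ₗ ψ j
  have hφ : ∀ h j c, φ h j c = h (ψ j c) := fun h j c => rfl
  have hφ' : ∀ h h' j, φ (h + h') j = φ h j + φ h' j := fun h h' j => rfl
  let e : Fin n → Fin n → Rᵐᵒᵖ := fun j => Pi.single j 1
  have hsum : ∀ q : Fin n → Rᵐᵒᵖ, ∑ j, q j • e j = q := fun q => by
    simpa [e] using (Pi.basisFun Rᵐᵒᵖ (Fin n)).sum_repr q
  have hg : ∀ g : (Fin n → Rᵐᵒᵖ) →ₗ[Rᵐᵒᵖ] C, ∑ j, ψ j (g (e j)) = g := fun g => by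
    refine LinearMap.ext fun q => ?_
    rw [LinearMap.sum_apply]
    simp only [hψ, ← map_smul, ← map_sum, hsum]
  refine Function.bijective_iff_has_inverse.2
    ⟨fun h => ∑ j, tmul R (e j) (φ h j), fun x => ?_, fun h => ?_⟩
  · induction x using induction_on with
    | zero =>
      refine Finset.sum_eq_zero fun j _ => ?_
      rw [map_zero]
      exact map_zero (mk R _ _ (e j))
    | tmul q f =>
      have h : ∀ j, φ (tensorHomEval S C N _ (tmul R q f)) j = (q j).unop • f := fun j => rfl
      simp only [h, ← smul_tmul, MulOpposite.op_unop]
      rw [← sum_tmul, hsum]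
    | add x y hx hy =>
      simp only [map_add, hφ', tmul_add, Finset.sum_add_distrib] at hx hy ⊢
      rw [hx, hy]
  · refine LinearMap.ext fun g => ?_
    rw [map_sum, LinearMap.sum_apply]
    simp only [tensorHomEval_tmul, hφ, ← map_sum, hg]

section

variable (hS : IsSuperFinitelyPresented S C) (hN : IsWeakInjective S N)
  {K : Type u} [AddCommGroup K] [Module Rᵐᵒᵖ K]

include hS hN

/-- A map `K* → N` extends to `(R^n)*` because the cokernel `K'*` has `Ext¹(K'*, N) = 0`. The
extension comes from the free module, and its preimage is pushed forward to `K`. -/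
theorem tensorHomEval_surjective (hK : IsTotallyDualizable Rᵐᵒᵖ S C K) :
    Function.Surjective (tensorHomEval (R := R) S C N K) := by
  obtain ⟨n, p, hp, hk⟩ := hK.exists_cover hS
  have hip := LinearMap.exact_subtype_ker_map p
  intro g
  obtain ⟨g', rfl⟩ := exists_extension_of_ext_one (lcomp_injective S C hp)
    (lcomp_surjective S C (LinearMap.ker p).injective_subtype hp hip (hK.ext 1 le_rfl))
    (lcomp_exact S C hp hip) (hN _ hk.dual) g
  obtain ⟨x, rfl⟩ := (tensorHomEval_bijective_of_free n).2 g'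
  exact ⟨rTensor R _ p x, tensorHomEval_rTensor p x⟩

theorem tensorHomEval_injective (hK : IsTotallyDualizable Rᵐᵒᵖ S C K) :
    Function.Injective (tensorHomEval (R := R) S C N K) := by
  obtain ⟨n, p, hp, hk⟩ := hK.exists_cover hS
  have hip := LinearMap.exact_subtype_ker_map p
  refine (injective_iff_map_eq_zero _).2 fun x hx => ?_
  obtain ⟨y, rfl⟩ := rTensor_surjective _ hp x
  rw [tensorHomEval_rTensor] at hx
  have hs := lcomp_surjective S C (LinearMap.ker p).injective_subtype hp hip (hK.ext 1 le_rfl)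
  -- The image of `y` vanishes on `K*`, hence factors through `K'*`. Surjectivity for the syzygy
  -- then shows that `y` itself comes from the syzygy.
  obtain ⟨g, hg⟩ := (lcomp_exact ℤ N hs (lcomp_exact S C hp hip) (tensorHomEval S C N _ y)).1 hx
  obtain ⟨z, hz⟩ := tensorHomEval_surjective hS hN hk g
  have hy : rTensor R _ (LinearMap.ker p).subtype z = y := by
    refine (tensorHomEval_bijective_of_free n).1 ?_
    rw [tensorHomEval_rTensor, hz, ← hg, LinearMap.lcomp_apply']
  rw [← hy]
  exact (rTensor_exact _ hp hip).apply_apply_eq_zero z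

theorem subsingleton_torGroup_bimoduleHom (i : ℕ) (hi : 1 ≤ i)
    (hK : IsTotallyDualizable Rᵐᵒᵖ S C K) :
    Subsingleton (TorGroup R (BimoduleHom R S C N) K i) := by
  induction i, hi using Nat.le_induction generalizing K with
  | base =>
    obtain ⟨n, p, hp, hk⟩ := hK.exists_cover hS
    have hip := LinearMap.exact_subtype_ker_map p
    refine subsingleton_torGroup_one .of_free inferInstance (LinearMap.ker p).injective_subtype
      hp hip hk.isSuperFinitelyPresented ((injective_iff_map_eq_zero _).2 fun x hx => ?_)
    have hs := lcomp_surjective S C (LinearMap.ker p).injective_subtype hp hip (hK.ext 1 le_rfl)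
    -- Every functional in `K'*` extends to the free module, so `x` has zero image under the natural
    -- map of the syzygy, where that map is injective.
    refine (injective_iff_map_eq_zero _).1 (tensorHomEval_injective hS hN hk) x ?_
    have h := tensorHomEval_rTensor (LinearMap.ker p).subtype x
    rw [hx, map_zero] at h
    refine LinearMap.ext fun f => ?_
    obtain ⟨f, rfl⟩ := hs f
    exact (LinearMap.congr_fun h f).symm
  | succ i hi ih =>
    obtain ⟨n, p, hp, hk⟩ := hK.exists_cover hS
    exact subsingleton_torGroup_succ .of_free inferInstance (LinearMap.ker p).injective_subtype hp
      (LinearMap.exact_subtype_ker_map p) hk.isSuperFinitelyPresented hi (ih hk)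

end

theorem IsWeakInjective.subsingleton_ext (hN : IsWeakInjective S N) (i : ℕ) (hi : 1 ≤ i)
    {F : Type u} [AddCommGroup F] [Module S F] (hF : IsSuperFinitelyPresented S F) :
    Subsingleton (Ext (ModuleCat.of S F) (ModuleCat.of S N) i) := by
  induction i, hi using Nat.le_induction generalizing F with
  | base => exact hN F hF
  | succ i hi ih =>
    obtain ⟨P, p, hP, hP', hp, hk⟩ := hF.exists_cover
    exact subsingleton_ext_succ hP (LinearMap.ker p).injective_subtype hp
      (LinearMap.exact_subtype_ker_map p) (ih hk)

end Bass

/-! ### Specialization to `K = C` -/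

section Semidualizing

variable {R S C : Type u} [Ring R] [Ring S] [AddCommGroup C] [Module S C]
  [Module Rᵐᵒᵖ C] [SMulCommClass S Rᵐᵒᵖ C] (hC : IsSemidualizing R S C)

include hC

theorem IsSemidualizing.isTotallyDualizable_left : IsTotallyDualizable S Rᵐᵒᵖ C C := by
  refine isTotallyDualizable_self hC.a1 hC.c1 (.ofBijective (homothety S Rᵐᵒᵖ C) ?_)
  exact hC.b2.comp MulOpposite.unop_bijective

theorem IsSemidualizing.inAuslanderClass {M : Type u} [AddCommGroup M] [Module R M]
    (hM : IsWeakFlat R M) : InAuslanderClass R S C M where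
  A1 i hi := hM.subsingleton_torGroup i hi hC.a2
  A2 i hi := subsingleton_ext_balancedTensor hC.a2 hM i hi hC.isTotallyDualizable_left
  A3 := by
    have h : Function.Bijective (homTensorEval (S := S) R C M C) :=
      ⟨homTensorEval_injective hC.a2 hM hC.isTotallyDualizable_left,
        homTensorEval_surjective hC.a2 hM hC.isTotallyDualizable_left⟩
    -- By definition `μ_M` is the composite `m ↦ id ⊗ m ↦ (c ↦ c ⊗ m)`.
    exact h.comp (tmul_id_bijective hC.b2)

theorem IsSemidualizing.inBassClass {N : Type u} [AddCommGroup N] [Module S N]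
    (hN : IsWeakInjective S N) : InBassClass R S C N := by
  have : SMulCommClass Rᵐᵒᵖ S C := SMulCommClass.symm _ _ _
  let e : S ≃ₗ[S] (C →ₗ[Rᵐᵒᵖ] C) := .ofBijective (homothety Rᵐᵒᵖ S C) hC.b1
  have hd : IsTotallyDualizable Rᵐᵒᵖ S C C := isTotallyDualizable_self hC.a2 hC.c2 e
  refine ⟨fun i hi => hN.subsingleton_ext i hi hC.a1,
    fun i hi => subsingleton_torGroup_bimoduleHom hC.a1 hN i hi hd, ?_⟩
  -- `ν_N` is the natural map for `K = C` followed by evaluation at the identity of `C`.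
  have h : ⇑(bassEval R S C N) = (fun g => g LinearMap.id) ∘ tensorHomEval S C N C := by
    funext x
    induction x using BalancedTensor.induction_on with
    | zero => simp
    | tmul c f => rfl
    | add x y hx hy =>
      rw [map_add, hx, hy, Function.comp_apply, Function.comp_apply, Function.comp_apply, map_add,
        LinearMap.add_apply]
  rw [h]
  exact (eval_id_bijective e (one_smul S LinearMap.id)).comp
    ⟨tensorHomEval_injective hC.a1 hN hd, tensorHomEval_surjective hC.a1 hN hd⟩

end Semidualizing

end

theorem theorem2p2 {R S : Type u} [Ring R] [Ring S] (C : Type u) [AddCommGroup C] [Module S C]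
    [Module Rᵐᵒᵖ C] [SMulCommClass S Rᵐᵒᵖ C] (hC : IsSemidualizing R S C) :
    (∀ (M : Type u) [AddCommGroup M] [Module R M], IsWeakFlat R M → InAuslanderClass R S C M) ∧
    (∀ (N : Type u) [AddCommGroup N] [Module S N], IsWeakInjective S N → InBassClass R S C N) :=
  ⟨fun _ _ _ hM => hC.inAuslanderClass hM, fun _ _ _ hN => hC.inBassClass hN⟩
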